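/- Theorem (adversarial lower bound). There is a universal constant $c > 0$ such that the following holds for all integers $K, T, m$ with $T \ge K \ge 4$ and $2 \le m \le K$. A preference matrix on the arms $[K]=\{1,\dots,K\}$ is a matrix $P \in [0,1]^{K\times K}$ with $P(i,j)+P(j,i)=1$ and $P(i,i)=1/2$ for all $i,j\in[K]$. In each round $t \in [T]$ a (possibly randomized) multi-dueling bandit algorithm, on the basis of its past selections and observations, selects a multiset $\mathcal A_t = \{\mathcal A_t(1),\dots,\mathcal A_t(m)\}$ of $m$ arms from $[K]$ (repetitions are allowed) and then observes only a winning index $I_t \in [m]$ (so the winning arm is $\mathcal A_t(I_t)$), which, given the past and $\mathcal A_t$, equals $i$ with probability $$W(i \mid \mathcal A_t, P_t) = \sum_{j \ne i} \frac{2 P_t(\mathcal A_t(i), \mathcal A_t(j))}{m(m-1)}.$$ Then for every such algorithm there exist a sequence $P_1,\dots,P_T$ of preference matrices, fixed in advance (an oblivious adversary), and an arm $a^\star \in [K]$ that is a Condorcet winner in every round, that is, $P_t(a^\star,i) \ge 1/2$ for all $i\in[K]$ and $t\in[T]$, such that $$\mathbb E\left[\sum_{t=1}^T \frac1m \sum_{j=1}^m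 \Delta_t(\mathcal A_t(j))\right] \ge c\sqrt{KT}, \qquad \Delta_t(i) := P_t(a^\star,i) - \tfrac12,$$ where the expectation is over the randomness of the algorithm and of the observed winners. -/

import Mathlib

namespace MultiDueling

/-- A preference matrix on `K` arms: entries in `[0, 1]`, reciprocity and self-comparison. -/
structure PreferenceMatrix (K : ℕ) where
  prob : Fin K → Fin K → ℝ
  nonneg : ∀ i j, 0 ≤ prob i j
  le_one : ∀ i j, prob i j ≤ 1
  reciprocal : ∀ i j, prob i j + prob j i = 1
  self_half : ∀ i, prob i i = 1 / 2

/-- A multiset of `m` arms, listed as `A 0, …, A (m - 1)`; repetitions are allowed. -/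
abbrev Selection (K m : ℕ) : Type := Fin m → Fin K

/-- What the learner sees in one round: its selection and the index in `Fin m` of the winner
(which determines the winning arm). -/
abbrev Observation (K m : ℕ) : Type := Selection K m × Fin m

/-- The history of the first `t` rounds. -/
abbrev History (K m t : ℕ) : Type := Fin t → Observation K m

/-- The pairwise-subset choice model: the probability that the arm at index `i` wins. -/
noncomputable def winProb {K m : ℕ} (P : PreferenceMatrix K) (A : Selection K m) (i : Fin m) : ℝ :=
  ∑ j ∈ Finset.univ.erase i, 2 * P.prob (A i) (A j) / ((m : ℝ) * ((m : ℝ) - 1))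

theorem winProb_nonneg {K m : ℕ} (hm : 2 ≤ m) (P : PreferenceMatrix K) (A : Selection K m)
    (i : Fin m) : 0 ≤ winProb P A i := by
  have h2 : (2 : ℝ) ≤ m := by exact_mod_cast hm
  refine Finset.sum_nonneg fun j _ => div_nonneg ?_ (mul_nonneg (by linarith) (by linarith))
  exact mul_nonneg (by norm_num) (P.nonneg _ _)

theorem sum_winProb {K m : ℕ} (hm : 2 ≤ m) (P : PreferenceMatrix K) (A : Selection K m) :
    ∑ i, winProb P A i = 1 := by
  have h2 : (2 : ℝ) ≤ m := by exact_mod_cast hm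
  have hD : (m : ℝ) * ((m : ℝ) - 1) ≠ 0 :=
    mul_ne_zero (by linarith) (by intro h; linarith)
  have herase : ∀ i : Fin m, ∑ j ∈ Finset.univ.erase i, P.prob (A i) (A j)
      = (∑ j, P.prob (A i) (A j)) - 1 / 2 := by
    intro i
    rw [← Finset.sum_erase_add _ _ (Finset.mem_univ i), P.self_half]
    ring
  have hswap : (∑ i : Fin m, ∑ j, P.prob (A i) (A j)) = ∑ i : Fin m, ∑ j, P.prob (A j) (A i) :=
    Finset.sum_comm
  have htot : (∑ i : Fin m, ∑ j, P.prob (A i) (A j)) + ∑ i : Fin m, ∑ j, P.prob (A j) (A i)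
      = (m : ℝ) * m := by
    simp only [← Finset.sum_add_distrib, P.reciprocal]
    simp
  have hS : ∑ i : Fin m, ∑ j, P.prob (A i) (A j) = (m : ℝ) * m / 2 := by linarith
  simp only [winProb, ← Finset.sum_div, ← Finset.mul_sum, herase, Finset.sum_sub_distrib, hS]
  rw [div_eq_one_iff_eq hD]
  simp
  ring

/-- The law of the index of the winner. -/
noncomputable def winnerLaw {K m : ℕ} (hm : 2 ≤ m) (P : PreferenceMatrix K) (A : Selection K m) :
    PMF (Fin m) :=
  PMF.ofFintype (fun i => ENNReal.ofReal (winProb P A i)) (by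
    rw [← ENNReal.ofReal_sum_of_nonneg fun i _ => winProb_nonneg hm P A i, sum_winProb hm P A,
      ENNReal.ofReal_one])

/-- A randomized multi-dueling bandit algorithm: for each round `t` (counted from `0`) and each
history of the previous rounds, the conditional law of the next selection. -/
abbrev Algorithm (K m : ℕ) : Type := ∀ t : ℕ, History K m t → PMF (Selection K m)

/-- The law of the history of the first `t` rounds when the algorithm `π` is run against the
oblivious sequence `P` of preference matrices. -/
noncomputable def historyLaw {K m : ℕ} (hm : 2 ≤ m) (π : Algorithm K m)
    (P : ℕ → PreferenceMatrix K) : ∀ t : ℕ, PMF (History K m t)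
  | 0 => PMF.pure Fin.elim0
  | t + 1 => (historyLaw hm π P t).bind fun h => (π t h).bind fun A =>
      (winnerLaw hm (P t) A).bind fun I => PMF.pure (Fin.snoc h (A, I))

/-- The arm `a` is a Condorcet winner in each of the first `T` rounds. -/
def IsCondorcetWinner {K : ℕ} (P : ℕ → PreferenceMatrix K) (T : ℕ) (a : Fin K) : Prop :=
  ∀ t < T, ∀ i, 1 / 2 ≤ (P t).prob a i

/-- The gap of the arm `i` with respect to the arm `a`. -/
noncomputable def gap {K : ℕ} (P : PreferenceMatrix K) (a i : Fin K) : ℝ := P.prob a i - 1 / 2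

/-- The cumulative Condorcet pseudo-regret along a history of `T` rounds. -/
noncomputable def condorcetRegret {K m T : ℕ} (P : ℕ → PreferenceMatrix K) (a : Fin K)
    (h : History K m T) : ℝ :=
  ∑ t : Fin T, 1 / (m : ℝ) * ∑ j : Fin m, gap (P t) a ((h t).1 j)

/-- The expectation of the Condorcet pseudo-regret after `T` rounds, over the randomness of the
algorithm and of the winners. The space of histories is finite. -/
noncomputable def expectedRegret {K m : ℕ} (hm : 2 ≤ m) (π : Algorithm K m)
    (P : ℕ → PreferenceMatrix K) (a : Fin K) (T : ℕ) : ℝ :=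
  ∑ h : History K m T, (historyLaw hm π P T h).toReal * condorcetRegret P a h

end MultiDueling

/-! A constant sequence suffices: a hidden arm `a` beats every other arm with probability `1/2 + ε`,
and all other duels are fair. The regret is then `ε (T - E_a[N_a])`, where `N_a` (`armTime`) is the
time spent on `a`, so some `a` must have `E_a[N_a] ≤ T/2`.

Compare with the null model, in which the winner is uniform and the expected `N_a` sum to `T`. A
selection with `n` copies of `a` carries information at most `32 ε² n/m` about `a`
(`sum_advantage_sq_le`), a bound proportional to its share of the round, with no further dependence
on `m`. Hence the KL divergence from the null model is at most `32 ε² E_0[N_a]`. A Hellinger-type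
change of measure turns this into a bound on `E_a[N_a]`; averaging over `a` with `ε` of order
`√(K/T)` gives the arm. -/

namespace MultiDueling

variable {K m : ℕ}

/-! ### Laws of histories and likelihood ratios -/

section Histories

variable (hm : 2 ≤ m) (π : Algorithm K m) (P : ℕ → PreferenceMatrix K)

/-- The probability of a history of `t` rounds, as a real number. -/
noncomputable def historyProb (t : ℕ) (h : History K m t) : ℝ := (historyLaw hm π P t h).toReal

theorem historyProb_nonneg (t : ℕ) (h : History K m t) : 0 ≤ historyProb hm π P t h :=
  ENNReal.toReal_nonneg

theorem sum_toReal_pmf {α : Type*} [Fintype α] (p : PMF α) : ∑ a, (p a).toReal = 1 := by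
  have h := p.tsum_coe
  rw [tsum_fintype] at h
  rw [← ENNReal.toReal_sum fun a _ => p.apply_ne_top a, h, ENNReal.toReal_one]

theorem sum_historyProb (t : ℕ) : ∑ h, historyProb hm π P t h = 1 := sum_toReal_pmf _

/-- `Fin.snoc` is injective, so a single term of the nested binds survives. -/
theorem historyLaw_snoc (t : ℕ) (h : History K m t) (A : Selection K m) (I : Fin m) :
    historyLaw hm π P (t + 1) (Fin.snoc h (A, I) : History K m (t + 1))
      = historyLaw hm π P t h * (π t h A * winnerLaw hm (P t) A I) := by
  classical
  have key : ∀ (h' : History K m t) (A' : Selection K m) (I' : Fin m),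
      ((Fin.snoc h (A, I) : History K m (t + 1)) = Fin.snoc h' (A', I'))
        ↔ h = h' ∧ A = A' ∧ I = I' := by
    intro h' A' I'
    rw [Fin.snoc_inj, Prod.mk.injEq]
  simp only [historyLaw, PMF.bind_apply, PMF.pure_apply, tsum_fintype, key]
  rw [Finset.sum_eq_single h]
  · rw [Finset.sum_eq_single A]
    · rw [Finset.sum_eq_single I]
      · simp
      · intro b _ hb
        simp [hb.symm]
      · simp
    · intro b _ hb
      simp [hb.symm]
    · simp
  · intro b _ hb
    simp [hb.symm]
  · simp

theorem historyProb_snoc (t : ℕ) (h : History K m t) (A : Selection K m) (I : Fin m) :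
    historyProb hm π P (t + 1) (Fin.snoc h (A, I) : History K m (t + 1))
      = historyProb hm π P t h * ((π t h A).toReal * winProb (P t) A I) := by
  rw [historyProb, historyLaw_snoc, ENNReal.toReal_mul, ENNReal.toReal_mul, winnerLaw,
    PMF.ofFintype_apply, ENNReal.toReal_ofReal (winProb_nonneg hm _ _ _), historyProb]

theorem sum_history_succ {t : ℕ} (f : History K m (t + 1) → ℝ) :
    ∑ h, f h = ∑ h : History K m t, ∑ A : Selection K m, ∑ I : Fin m,
      f (Fin.snoc h (A, I) : History K m (t + 1)) := by
  rw [← (Fin.snocEquiv fun _ : Fin (t + 1) => Observation K m).sum_comp, Fintype.sum_prod_type,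
    Finset.sum_comm]
  refine Finset.sum_congr rfl fun h _ => ?_
  rw [Fintype.sum_prod_type]
  rfl

/-- If an additive functional of the history has nonpositive conditional mean increments, then its
mean is nonpositive. -/
theorem sum_historyProb_mul_nonpos (g : Selection K m → Fin m → ℝ)
    (hg : ∀ t A, ∑ I, winProb (P t) A I * g A I ≤ 0) (t : ℕ) :
    ∑ h, historyProb hm π P t h * ∑ s, g (h s).1 (h s).2 ≤ 0 := by
  induction t with
  | zero => simp
  | succ t ih =>
    rw [sum_history_succ]
    refine le_trans (Finset.sum_le_sum fun h _ => ?_) ih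
    have hsum : ∀ A I, ∑ s, g ((Fin.snoc h (A, I) : History K m (t + 1)) s).1
          ((Fin.snoc h (A, I) : History K m (t + 1)) s).2
        = (∑ s, g (h s).1 (h s).2) + g A I := by
      intro A I
      rw [Fin.sum_univ_castSucc]
      simp
    set S := ∑ s, g (h s).1 (h s).2
    have hstep : ∀ A, ∑ I, historyProb hm π P (t + 1) (Fin.snoc h (A, I) : History K m (t + 1)) *
        (S + g A I) ≤ historyProb hm π P t h * S * (π t h A).toReal := by
      intro A
      have e : ∑ I, historyProb hm π P (t + 1) (Fin.snoc h (A, I) : History K m (t + 1)) *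
          (S + g A I) = historyProb hm π P t h * (π t h A).toReal *
            (S * (∑ I, winProb (P t) A I) + ∑ I, winProb (P t) A I * g A I) := by
        rw [Finset.mul_sum, ← Finset.sum_add_distrib, Finset.mul_sum]
        refine Finset.sum_congr rfl fun I _ => ?_
        rw [historyProb_snoc]
        ring
      rw [e, sum_winProb hm]
      have h0 : 0 ≤ historyProb hm π P t h * (π t h A).toReal :=
        mul_nonneg (historyProb_nonneg _ _ _ _ _) ENNReal.toReal_nonneg
      nlinarith [mul_nonneg h0 (neg_nonneg.mpr (hg t A))]
    simp only [hsum]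
    refine le_trans (Finset.sum_le_sum fun A _ => hstep A) ?_
    rw [← Finset.mul_sum, sum_toReal_pmf, mul_one]

/-- Change of measure: the probability under `Q` is the probability under `P` times the likelihood
ratio. -/
theorem historyProb_eq_mul_prod (Q : ℕ → PreferenceMatrix K) (r : Selection K m → Fin m → ℝ)
    (hr : ∀ t A I, winProb (Q t) A I = winProb (P t) A I * r A I) (t : ℕ) (h : History K m t) :
    historyProb hm π Q t h = historyProb hm π P t h * ∏ s, r (h s).1 (h s).2 := by
  induction t with
  | zero => simp [historyProb, historyLaw]
  | succ t ih =>
    induction h using Fin.snocCases with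
    | snoc h x =>
      obtain ⟨A, I⟩ := x
      rw [historyProb_snoc, historyProb_snoc, ih, hr, Fin.prod_univ_castSucc]
      simp only [Fin.snoc_castSucc, Fin.snoc_last]
      ring

end Histories

/-! ### Comparison of means through the KL divergence -/

/-- A change of measure bound: if `q = p L` with `p` and `q` probability vectors and `L > 0`, then
the means of a function with values in `[0, B]` differ by at most `B (8 KL(p, q) + 1 / 8)`. -/
theorem sum_mul_le_sum_mul_add_log {α : Type*} [Fintype α] (p L f : α → ℝ) (B : ℝ)
    (hp : ∀ x, 0 ≤ p x) (hL : ∀ x, 0 < L x) (hp1 : ∑ x, p x = 1) (hq1 : ∑ x, p x * L x = 1)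
    (hf0 : ∀ x, 0 ≤ f x) (hfB : ∀ x, f x ≤ B) (hB : 0 ≤ B) :
    ∑ x, p x * L x * f x ≤ ∑ x, p x * f x + B * (8 * (∑ x, p x * -Real.log (L x)) + 1 / 8) := by
  -- With `s = √L`, write `L - 1 = (s - 1)(s + 1)` and apply AM-GM; then `(s - 1)² ≤ L - 1 - log L`
  -- and `(s + 1)² ≤ 2L + 2`. On summation `129/16 - 127/16` leaves `1/8`.
  have hpt : ∀ x, p x * L x * f x ≤ p x * f x + B * (8 * (p x * -Real.log (L x))
      + 129 / 16 * (p x * L x) - 127 / 16 * p x) := by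
    intro x
    have hs : Real.sqrt (L x) ^ 2 = L x := Real.sq_sqrt (hL x).le
    have hs0 : 0 < Real.sqrt (L x) := Real.sqrt_pos.mpr (hL x)
    have hlog : Real.log (L x) ≤ 2 * (Real.sqrt (L x) - 1) := by
      have h := Real.log_le_sub_one_of_pos hs0
      rw [Real.log_sqrt (hL x).le] at h
      linarith
    set s := Real.sqrt (L x)
    have hmain : (L x - 1) * f x ≤ B * (8 * -Real.log (L x) + 129 / 16 * L x - 127 / 16) := by
      have hlow : 8 * (s - 1) ^ 2 + (s + 1) ^ 2 / 32 ≤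
          8 * -Real.log (L x) + 129 / 16 * L x - 127 / 16 := by
        rw [← hs] at hlog ⊢
        nlinarith [sq_nonneg (s - 1)]
      have hamgm : L x - 1 ≤ 8 * (s - 1) ^ 2 + (s + 1) ^ 2 / 32 := by
        rw [← hs]
        nlinarith [sq_nonneg (16 * (s - 1) - (s + 1))]
      have hpos : 0 ≤ 8 * (s - 1) ^ 2 + (s + 1) ^ 2 / 32 := by positivity
      calc (L x - 1) * f x ≤ (8 * (s - 1) ^ 2 + (s + 1) ^ 2 / 32) * f x :=
            mul_le_mul_of_nonneg_right hamgm (hf0 x)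
        _ ≤ (8 * (s - 1) ^ 2 + (s + 1) ^ 2 / 32) * B := mul_le_mul_of_nonneg_left (hfB x) hpos
        _ ≤ _ := by
          rw [mul_comm]
          exact mul_le_mul_of_nonneg_left hlow hB
    have := mul_le_mul_of_nonneg_left hmain (hp x)
    linarith
  refine le_trans (Finset.sum_le_sum fun x _ => hpt x) (le_of_eq ?_)
  rw [Finset.sum_add_distrib, ← Finset.mul_sum, Finset.sum_sub_distrib, Finset.sum_add_distrib,
    ← Finset.mul_sum, ← Finset.mul_sum, ← Finset.mul_sum, hp1, hq1]
  ring

/-! ### Hard instances and the information in one round -/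

/-- The indicator of the arm `a`. -/
def armIndicator (a i : Fin K) : ℝ := if i = a then 1 else 0

theorem armIndicator_nonneg (a i : Fin K) : 0 ≤ armIndicator a i := by
  unfold armIndicator; split_ifs <;> norm_num

theorem armIndicator_le_one (a i : Fin K) : armIndicator a i ≤ 1 := by
  unfold armIndicator; split_ifs <;> norm_num

theorem armIndicator_sq (a i : Fin K) : armIndicator a i ^ 2 = armIndicator a i := by
  unfold armIndicator; split_ifs <;> norm_num

/-- The arm `a` beats each other arm with probability `1 / 2 + ε`, and all other duels are fair. -/
noncomputable def favoring (ε : ℝ) (h0 : 0 ≤ ε) (h1 : ε ≤ 1 / 2) (a : Fin K) :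
    PreferenceMatrix K where
  prob i j := 1 / 2 + ε * (armIndicator a i - armIndicator a j)
  nonneg i j := by
    nlinarith [armIndicator_nonneg a i, armIndicator_le_one a j,
      mul_nonneg h0 (add_nonneg (armIndicator_nonneg a i)
        (sub_nonneg.mpr (armIndicator_le_one a j)))]
  le_one i j := by
    nlinarith [mul_nonneg h0 (add_nonneg (armIndicator_nonneg a j)
        (sub_nonneg.mpr (armIndicator_le_one a i)))]
  reciprocal i j := by ring
  self_half i := by ring

/-- The number of copies of the arm `a` in a selection. -/
def copies (a : Fin K) (A : Selection K m) : ℝ := ∑ j, armIndicator a (A j)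

theorem copies_nonneg (a : Fin K) (A : Selection K m) : 0 ≤ copies a A :=
  Finset.sum_nonneg fun _ _ => armIndicator_nonneg _ _

theorem copies_le (a : Fin K) (A : Selection K m) : copies a A ≤ m := by
  refine le_trans (Finset.sum_le_sum fun _ _ => armIndicator_le_one _ _) ?_
  simp

theorem sum_copies (A : Selection K m) : ∑ a, copies a A = m := by
  unfold copies
  rw [Finset.sum_comm]
  simp [armIndicator]

/-- The relative advantage, over the uniform law, of the index `i` in the selection `A`, when the
arm `a` is favored by `ε`. -/
noncomputable def advantage (ε : ℝ) (a : Fin K) (A : Selection K m) (i : Fin m) : ℝ :=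
  2 * ε / ((m : ℝ) - 1) * (m * armIndicator a (A i) - copies a A)

theorem winProb_favoring (hm : 2 ≤ m) {ε : ℝ} (h0 : 0 ≤ ε) (h1 : ε ≤ 1 / 2) (a : Fin K)
    (A : Selection K m) (i : Fin m) :
    winProb (favoring ε h0 h1 a) A i = 1 / m * (1 + advantage ε a A i) := by
  have h2 : (2 : ℝ) ≤ m := by exact_mod_cast hm
  have hm0 : (m : ℝ) ≠ 0 := by linarith
  have hm1 : (m : ℝ) - 1 ≠ 0 := by intro h; linarith
  have hsum : ∑ j ∈ Finset.univ.erase i, (favoring ε h0 h1 a).prob (A i) (A j)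
      = ((m : ℝ) - 1) / 2 + ε * (m * armIndicator a (A i) - copies a A) := by
    have h := Finset.sum_erase_add Finset.univ
      (fun j => (favoring ε h0 h1 a).prob (A i) (A j)) (Finset.mem_univ i)
    rw [(favoring ε h0 h1 a).self_half] at h
    have hfull : ∑ j, (favoring ε h0 h1 a).prob (A i) (A j)
        = (m : ℝ) / 2 + ε * (m * armIndicator a (A i) - copies a A) := by
      simp only [favoring, Finset.sum_add_distrib, ← Finset.mul_sum, Finset.sum_sub_distrib,
        copies]
      simp
      ring
    linarith
  rw [winProb, ← Finset.sum_div, ← Finset.mul_sum, hsum, advantage]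
  field_simp

theorem sum_advantage (ε : ℝ) (a : Fin K) (A : Selection K m) :
    ∑ i, advantage ε a A i = 0 := by
  unfold advantage
  rw [← Finset.mul_sum, Finset.sum_sub_distrib, ← Finset.mul_sum]
  simp [copies]

theorem advantage_ge (hm : 2 ≤ m) {ε : ℝ} (h0 : 0 ≤ ε) (a : Fin K) (A : Selection K m)
    (i : Fin m) : -(4 * ε) ≤ advantage ε a A i := by
  have h2 : (2 : ℝ) ≤ m := by exact_mod_cast hm
  have hm1 : 0 < (m : ℝ) - 1 := by linarith
  have hd : 0 ≤ (m : ℝ) * armIndicator a (A i) :=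
    mul_nonneg (by linarith) (armIndicator_nonneg _ _)
  rw [advantage, div_mul_eq_mul_div, le_div_iff₀ hm1]
  nlinarith [copies_le a A, mul_nonneg h0 (sub_nonneg.mpr (copies_le a A)), mul_nonneg h0 hd,
    mul_nonneg h0 (sub_nonneg.mpr h2)]

/-- With `n` copies of `a` the sum is exactly `(2ε/(m-1))² m n (m - n)`; drop `-n` and use `m ≤ 2(m
- 1)`. -/
theorem sum_advantage_sq_le (hm : 2 ≤ m) (ε : ℝ) (a : Fin K) (A : Selection K m) :
    ∑ i, advantage ε a A i ^ 2 ≤ 16 * ε ^ 2 * copies a A := by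
  have h2 : (2 : ℝ) ≤ m := by exact_mod_cast hm
  have hm1 : 0 < (m : ℝ) - 1 := by linarith
  have hterm : ∀ i, advantage ε a A i ^ 2 = (2 * ε / ((m : ℝ) - 1)) ^ 2 *
      (((m : ℝ) ^ 2 - 2 * m * copies a A) * armIndicator a (A i) + copies a A ^ 2) := by
    intro i
    rw [advantage, mul_pow]
    congr 1
    linear_combination (m : ℝ) ^ 2 * armIndicator_sq a (A i)
  simp only [hterm]
  rw [← Finset.mul_sum, Finset.sum_add_distrib, ← Finset.mul_sum, ← copies]
  simp only [Finset.sum_const, Finset.card_univ, Fintype.card_fin, nsmul_eq_mul]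
  rw [div_pow, div_mul_eq_mul_div, div_le_iff₀ (by positivity)]
  have hc := copies_nonneg a A
  set n := copies a A
  have hmm : (m : ℝ) ^ 2 ≤ 4 * ((m : ℝ) - 1) ^ 2 := by nlinarith
  have h3 : 0 ≤ ε ^ 2 * n * (4 * ((m : ℝ) - 1) ^ 2 - m ^ 2) :=
    mul_nonneg (by positivity) (by linarith)
  have h4 : 0 ≤ ε ^ 2 * m * n ^ 2 := by positivity
  nlinarith

theorem neg_log_one_add_le {x : ℝ} (hx : -(1 / 2) ≤ x) : -Real.log (1 + x) ≤ -x + 2 * x ^ 2 := by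
  have hpos : 0 < 1 + x := by linarith
  have h := Real.log_le_sub_one_of_pos (inv_pos.mpr hpos)
  rw [Real.log_inv] at h
  refine h.trans ?_
  have e : (1 + x)⁻¹ - 1 = -x + x ^ 2 * (1 + x)⁻¹ := by
    field_simp
    ring
  rw [e]
  have hi : (1 + x)⁻¹ ≤ 2 := by
    rw [inv_le_comm₀ hpos (by norm_num)]
    linarith
  nlinarith [mul_le_mul_of_nonneg_left hi (sq_nonneg x)]

/-! ### Time spent on an arm, and regret -/

/-- The number of rounds spent on the arm `a`, each round being shared by the arms selected. -/
noncomputable def armTime {t : ℕ} (a : Fin K) (h : History K m t) : ℝ :=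
  ∑ s, copies a (h s).1 / m

theorem armTime_nonneg {t : ℕ} (a : Fin K) (h : History K m t) : 0 ≤ armTime a h :=
  Finset.sum_nonneg fun _ _ => div_nonneg (copies_nonneg _ _) (Nat.cast_nonneg _)

theorem armTime_le {t : ℕ} (a : Fin K) (h : History K m t) : armTime a h ≤ t := by
  have : armTime a h ≤ ∑ _s : Fin t, (1 : ℝ) :=
    Finset.sum_le_sum fun s _ => div_le_one_of_le₀ (copies_le a (h s).1) (Nat.cast_nonneg m)
  simpa using this

theorem sum_armTime (hm : 2 ≤ m) {t : ℕ} (h : History K m t) : ∑ a, armTime a h = t := by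
  have hm0 : (m : ℝ) ≠ 0 := by
    have : m ≠ 0 := by omega
    exact_mod_cast this
  unfold armTime
  rw [Finset.sum_comm]
  simp [← Finset.sum_div, sum_copies, hm0]

theorem condorcetRegret_favoring (hm : 2 ≤ m) {ε : ℝ} (h0 : 0 ≤ ε) (h1 : ε ≤ 1 / 2) (a : Fin K)
    {t : ℕ} (h : History K m t) :
    condorcetRegret (fun _ => favoring ε h0 h1 a) a h = ε * (t - armTime a h) := by
  have hm0 : (m : ℝ) ≠ 0 := by
    have : m ≠ 0 := by omega
    exact_mod_cast this
  have hround : ∀ s : Fin t, 1 / (m : ℝ) * ∑ j, gap (favoring ε h0 h1 a) a ((h s).1 j)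
      = ε * (1 - copies a (h s).1 / m) := by
    intro s
    have : ∑ j, gap (favoring ε h0 h1 a) a ((h s).1 j) = ε * (m - copies a (h s).1) := by
      simp [gap, favoring, copies, ← Finset.mul_sum, Finset.sum_sub_distrib, armIndicator]
    rw [this]
    field_simp
  simp only [condorcetRegret, hround]
  rw [← Finset.mul_sum, Finset.sum_sub_distrib]
  simp [armTime]

theorem expectedRegret_favoring (hm : 2 ≤ m) (π : Algorithm K m) {ε : ℝ} (h0 : 0 ≤ ε)
    (h1 : ε ≤ 1 / 2) (a : Fin K) (T : ℕ) :
    expectedRegret hm π (fun _ => favoring ε h0 h1 a) a T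
      = ε * (T - ∑ h, historyProb hm π (fun _ => favoring ε h0 h1 a) T h * armTime a h) := by
  have hterm : ∀ h : History K m T, (historyLaw hm π (fun _ => favoring ε h0 h1 a) T h).toReal *
      condorcetRegret (fun _ => favoring ε h0 h1 a) a h
      = ε * (T * historyProb hm π (fun _ => favoring ε h0 h1 a) T h
        - historyProb hm π (fun _ => favoring ε h0 h1 a) T h * armTime a h) := by
    intro h
    rw [condorcetRegret_favoring hm, historyProb]
    ring
  simp only [expectedRegret, hterm]
  rw [← Finset.mul_sum, Finset.sum_sub_distrib, ← Finset.mul_sum, sum_historyProb, mul_one]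

theorem isCondorcetWinner_favoring {ε : ℝ} (h0 : 0 ≤ ε) (h1 : ε ≤ 1 / 2) (a : Fin K) (T : ℕ) :
    IsCondorcetWinner (fun _ => favoring ε h0 h1 a) T a := by
  intro t _ i
  have : 0 ≤ ε * (1 - armIndicator a i) :=
    mul_nonneg h0 (sub_nonneg.mpr (armIndicator_le_one a i))
  simpa [favoring, armIndicator] using this

/-- Making `a` a favored arm raises the expected time spent on `a` by a controlled amount. -/
theorem sum_favoring_armTime_le (hm : 2 ≤ m) (π : Algorithm K m) {ε : ℝ} (h0 : 0 ≤ ε)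
    (h1 : ε ≤ 1 / 2) (h8 : ε ≤ 1 / 8) (P : ℕ → PreferenceMatrix K)
    (hP : ∀ t (A : Selection K m) i, winProb (P t) A i = 1 / m) (a : Fin K) (T : ℕ) :
    ∑ h, historyProb hm π (fun _ => favoring ε h0 h1 a) T h * armTime a h
      ≤ (1 + 256 * ε ^ 2 * T) * (∑ h, historyProb hm π P T h * armTime a h) + T / 8 := by
  have hm0 : (0 : ℝ) < m := by
    have : 0 < m := by omega
    exact_mod_cast this
  have hadv : ∀ A i, -(1 / 2) ≤ advantage (m := m) ε a A i := fun A i => by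
    linarith [advantage_ge hm h0 a A i]
  have hpos : ∀ A i, 0 < 1 + advantage (m := m) ε a A i := fun A i => by linarith [hadv A i]
  have hQ := historyProb_eq_mul_prod hm π P (fun _ => favoring ε h0 h1 a)
    (fun A i => 1 + advantage ε a A i)
    (fun t A i => by rw [winProb_favoring hm, hP]) T
  have hKL : ∑ h, historyProb hm π P T h * -Real.log (∏ s, (1 + advantage ε a (h s).1 (h s).2))
      ≤ 32 * ε ^ 2 * ∑ h, historyProb hm π P T h * armTime a h := by
    -- Chain rule for KL: under the uniform winner the first-order terms of the logarithm cancel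
    -- (`sum_advantage`), and the quadratic ones cost at most `2 * 16 ε² n/m`.
    have h := sum_historyProb_mul_nonpos hm π P
      (fun A i => -Real.log (1 + advantage ε a A i) - 32 * ε ^ 2 * (copies a A / m)) ?_ T
    · rw [← sub_nonpos, Finset.mul_sum, ← Finset.sum_sub_distrib]
      refine le_of_eq_of_le (Finset.sum_congr rfl fun h _ => ?_) h
      rw [Real.log_prod fun s _ => (hpos _ _).ne', Finset.sum_sub_distrib, ← Finset.mul_sum,
        Finset.sum_neg_distrib, armTime]
      ring
    · intro t A
      simp only [hP]
      rw [← Finset.mul_sum]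
      refine mul_nonpos_of_nonneg_of_nonpos (by positivity) ?_
      have hle : ∑ i, -Real.log (1 + advantage ε a A i)
          ≤ ∑ i, (-advantage ε a A i + 2 * advantage ε a A i ^ 2) :=
        Finset.sum_le_sum fun i _ => neg_log_one_add_le (hadv A i)
      rw [Finset.sum_add_distrib, Finset.sum_neg_distrib, Finset.sum_neg_distrib,
        sum_advantage, ← Finset.mul_sum] at hle
      have hsq := sum_advantage_sq_le hm ε a A
      rw [Finset.sum_sub_distrib, Finset.sum_neg_distrib]
      simp only [Finset.sum_const, Finset.card_univ, Fintype.card_fin, nsmul_eq_mul]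
      have e : (m : ℝ) * (32 * ε ^ 2 * (copies a A / m)) = 32 * ε ^ 2 * copies a A := by
        field_simp
      rw [e]
      linarith
  have hq1 := sum_historyProb hm π (fun _ => favoring ε h0 h1 a) T
  simp only [hQ] at hq1 ⊢
  have h := sum_mul_le_sum_mul_add_log (historyProb hm π P T)
    (fun h => ∏ s, (1 + advantage ε a (h s).1 (h s).2)) (armTime a) T
    (historyProb_nonneg hm π P T) (fun h => Finset.prod_pos fun s _ => hpos _ _)
    (sum_historyProb hm π P T) hq1 (armTime_nonneg a) (armTime_le a) (Nat.cast_nonneg T)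
  have := mul_le_mul_of_nonneg_left hKL (Nat.cast_nonneg (α := ℝ) T)
  linarith

theorem exists_favoring_armTime_le (hm : 2 ≤ m) (π : Algorithm K m) {ε : ℝ} (h0 : 0 ≤ ε)
    (h1 : ε ≤ 1 / 2) (h8 : ε ≤ 1 / 8) (T : ℕ) (hK : 4 ≤ K) (hε : 4096 * ε ^ 2 * T ≤ K) :
    ∃ a : Fin K,
      ∑ h, historyProb hm π (fun _ => favoring ε h0 h1 a) T h * armTime a h ≤ T / 2 := by
  have hK0 : (4 : ℝ) ≤ K := by exact_mod_cast hK
  let a₀ : Fin K := ⟨0, by omega⟩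
  -- The null model: at `ε = 0` all duels are fair, whichever arm is named.
  let P : ℕ → PreferenceMatrix K := fun _ => favoring 0 le_rfl (by norm_num) a₀
  have hP : ∀ t (A : Selection K m) i, winProb (P t) A i = 1 / m := fun t A i => by
    simp [P, winProb_favoring hm, advantage]
  have htot : ∑ a : Fin K, ∑ h, historyProb hm π P T h * armTime a h = T := by
    rw [Finset.sum_comm]
    simp only [← Finset.mul_sum, sum_armTime hm]
    rw [← Finset.sum_mul, sum_historyProb, one_mul]
  have hle : ∑ a : Fin K, ∑ h, historyProb hm π (fun _ => favoring ε h0 h1 a) T h * armTime a h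
      ≤ ∑ _a : Fin K, (T : ℝ) / 2 := by
    refine (Finset.sum_le_sum fun a _ => sum_favoring_armTime_le hm π h0 h1 h8 P hP a T).trans ?_
    rw [Finset.sum_add_distrib, ← Finset.mul_sum, htot]
    simp only [Finset.sum_const, Finset.card_univ, Fintype.card_fin, nsmul_eq_mul]
    have hT : (0 : ℝ) ≤ T := Nat.cast_nonneg T
    -- The three terms are at most `KT/4` (from `K ≥ 4`), `KT/16` (from `hε`) and `KT/8`, in total
    -- below `KT/2`.
    nlinarith [mul_le_mul_of_nonneg_right hε hT, mul_le_mul_of_nonneg_right hK0 hT]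
  obtain ⟨a, _, ha⟩ := Finset.exists_le_of_sum_le (Finset.univ_nonempty_iff.mpr ⟨a₀⟩) hle
  exact ⟨a, ha⟩

end MultiDueling

/-! ### Choice of the gap -/

theorem theorem3 :
    ∃ c : ℝ, 0 < c ∧ ∀ (K T m : ℕ), 4 ≤ K → K ≤ T → ∀ hm : 2 ≤ m, m ≤ K →
      ∀ π : MultiDueling.Algorithm K m,
        ∃ (P : ℕ → MultiDueling.PreferenceMatrix K) (a : Fin K),
          MultiDueling.IsCondorcetWinner P T a ∧
            c * Real.sqrt ((K : ℝ) * (T : ℝ)) ≤ MultiDueling.expectedRegret hm π P a T := by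
  refine ⟨1 / 128, by norm_num, fun K T m hK hKT hm _ π => ?_⟩
  have hK0 : (4 : ℝ) ≤ K := by exact_mod_cast hK
  have hKT' : (K : ℝ) ≤ T := by exact_mod_cast hKT
  have hT : (0 : ℝ) < T := by linarith
  set R := Real.sqrt ((K : ℝ) * T)
  have hR0 : 0 ≤ R := Real.sqrt_nonneg _
  have hR2 : R ^ 2 = K * T := Real.sq_sqrt (by positivity)
  have hRT : R ≤ T := by
    rw [← abs_of_nonneg hR0, ← abs_of_pos hT, ← sq_le_sq, hR2]
    nlinarith
  -- This is `√(K/T)/64`, which makes `hε` an equality; `K ≤ T` keeps it at most `1/64`. The regret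
  -- `ε T/2` is then `R/128`.
  set ε := R / (64 * T) with hεdef
  have h0 : 0 ≤ ε := by positivity
  have h64 : ε ≤ 1 / 64 := by
    rw [hεdef, div_le_iff₀ (by positivity)]
    linarith
  have hε : 4096 * ε ^ 2 * T ≤ K := by
    rw [hεdef, div_pow, hR2]
    apply le_of_eq
    field_simp
    norm_num
  obtain ⟨a, ha⟩ := MultiDueling.exists_favoring_armTime_le hm π h0 (by linarith) (by linarith) T
    hK hε
  refine ⟨_, a, MultiDueling.isCondorcetWinner_favoring h0 (by linarith) a T, ?_⟩
  rw [MultiDueling.expectedRegret_favoring]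
  have hRε : 1 / 128 * R = ε * (T / 2) := by
    rw [hεdef]
    field_simp
    ring
  rw [hRε]
  exact mul_le_mul_of_nonneg_left (by linarith) h0
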